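/- Let $n,q\ge 0$ be integers, $D_j=\frac1i\frac{\partial}{\partial x_j}$, and let $\mathcal D=\mathbb C[D_1,\dots,D_n]$ be the polynomial ring of constant coefficient partial differential operators on $\mathbb R^n$. Let $\mathcal C^\infty(\mathrm{protorus})$ be the space of smooth functions $\mathbb R^n\to\mathbb C$ that are periodic with respect to the lattice $2\pi N\mathbb Z^n$ for some integer $N\ge 1$ depending on the function, and let $\mathcal C^\infty(\mathrm{protorus})_{\mathrm{fin}}$ be the subspace of those whose Fourier series $\sum_{a\in\mathbb Q^n}c_a e^{i\langle a,x\rangle}$ is a finite sum. Let $\mathcal F=\mathcal C^\infty(\mathrm{protorus})_{\mathrm{fin}}[x_1,\dots,x_n]\subset \mathcal C^\infty(\mathbb R^n)$ be the algebra obtained by adjoining the coordinate functions $x_1,\dots,x_n$; it is a $\mathcal D$-module under differentiation. For a submodule $\mathcal M\subset\mathcal D^q$ let $$\mathcal M^\perp=\Big\{(f_1,\dots,f_q)\in\mathcal F^q \;:\; \sum_{j=1}^q r_j f_j=0 \text{ for all } (r_1,\dots,r_q)\in\mathcal M\Big\}$$ be its behavior in $\mathcal F^q$. **Theorem.** For every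 submodule $\mathcal M\subset\mathcal D^q$ the following are equivalent: 1. there are an integer $p\ge 0$ and a $q\times p$ matrix $L=L(D)$ with entries in $\mathcal D$ such that $\mathcal M^\perp$ is the image of the morphism $L(D):\mathcal F^p\to\mathcal F^q$, $g\mapsto\big(\sum_k L_{jk}g_k\big)_j$; 2. for every nonzero associated prime $\mathfrak p$ of the $\mathcal D$-module $\mathcal D^q/\mathcal M$, the variety $\mathcal V(\mathfrak p)=\{a\in\mathbb C^n : P(a)=0 \text{ for all } P=P(D_1,\dots,D_n)\in\mathfrak p\}$ contains no point of $\mathbb Q^n$. -/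

import Mathlib

open scoped ContDiff

noncomputable section

namespace PeriodicBehavior

/-- The ring `𝒟 = ℂ[D₁, …, Dₙ]` of constant coefficient partial differential operators; the
indeterminate `X j` stands for `D_j = (1/i) ∂/∂x_j`. -/
abbrev DiffRing (n : ℕ) : Type := MvPolynomial (Fin n) ℂ

/-- The algebra `C^∞(ℝⁿ)` of smooth complex-valued functions, with pointwise operations. -/
def smooth (n : ℕ) : Subalgebra ℂ ((Fin n → ℝ) → ℂ) where
  carrier := {f | ContDiff ℝ ∞ f}
  mul_mem' {f g} (hf : ContDiff ℝ ∞ f) (hg : ContDiff ℝ ∞ g) := ContDiff.mul hf hg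
  add_mem' {f g} (hf : ContDiff ℝ ∞ f) (hg : ContDiff ℝ ∞ g) := ContDiff.add hf hg
  algebraMap_mem' c := (contDiff_const : ContDiff ℝ ∞ fun _ : Fin n → ℝ => c)

variable {n : ℕ}

theorem smooth_contDiff (f : smooth n) : ContDiff ℝ ∞ (f : (Fin n → ℝ) → ℂ) := f.2

theorem smooth_differentiable (f : smooth n) : Differentiable ℝ (f : (Fin n → ℝ) → ℂ) :=
  (smooth_contDiff f).differentiable (by simp)

/-- The operator `D_j = (1/i) ∂/∂x_j` on `C^∞(ℝⁿ)`. -/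
def dOp (j : Fin n) : Module.End ℂ (smooth n) where
  toFun f := ⟨fun x => (1 / Complex.I) * fderiv ℝ (f : (Fin n → ℝ) → ℂ) x (Pi.single j 1),
    contDiff_const.mul (((smooth_contDiff f).fderiv_right (m := ∞) (by simp)).clm_apply
      contDiff_const)⟩
  map_add' f g := by
    ext x
    have h := fderiv_add (smooth_differentiable f x) (smooth_differentiable g x)
    change _ * fderiv ℝ ((f : (Fin n → ℝ) → ℂ) + (g : (Fin n → ℝ) → ℂ)) x _ =
      _ * fderiv ℝ (f : (Fin n → ℝ) → ℂ) x _ + _ * fderiv ℝ (g : (Fin n → ℝ) → ℂ) x _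
    rw [h, add_apply, mul_add]
  map_smul' c f := by
    ext x
    have h := fderiv_const_smul (smooth_differentiable f x) c
    change _ * fderiv ℝ (c • (f : (Fin n → ℝ) → ℂ)) x _ =
      c • (_ * fderiv ℝ (f : (Fin n → ℝ) → ℂ) x _)
    rw [h, smul_apply, smul_eq_mul, smul_eq_mul]
    ring

theorem dOp_apply (j : Fin n) (f : smooth n) (x : Fin n → ℝ) :
    (dOp j f : (Fin n → ℝ) → ℂ) x =
      (1 / Complex.I) * fderiv ℝ (f : (Fin n → ℝ) → ℂ) x (Pi.single j 1) := rfl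

theorem dOp_mul (j : Fin n) (f g : smooth n) : dOp j (f * g) = f * dOp j g + dOp j f * g := by
  ext x
  have h := fderiv_mul (smooth_differentiable f x) (smooth_differentiable g x)
  change _ * fderiv ℝ ((f : (Fin n → ℝ) → ℂ) * (g : (Fin n → ℝ) → ℂ)) x _ =
    (f : (Fin n → ℝ) → ℂ) x * (_ * fderiv ℝ (g : (Fin n → ℝ) → ℂ) x _) +
      (_ * fderiv ℝ (f : (Fin n → ℝ) → ℂ) x _) * (g : (Fin n → ℝ) → ℂ) x
  rw [h]
  simp only [add_apply, smul_apply, smul_eq_mul]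
  ring

theorem dOp_comm (j k : Fin n) : dOp j * dOp k = dOp k * dOp j := by
  have key : ∀ (a b : Fin n) (f : smooth n) (x : Fin n → ℝ),
      (dOp a (dOp b f) : (Fin n → ℝ) → ℂ) x = (1 / Complex.I) * ((1 / Complex.I) *
        fderiv ℝ (fderiv ℝ (f : (Fin n → ℝ) → ℂ)) x (Pi.single a 1) (Pi.single b 1)) := by
    intro a b f x
    have hd : DifferentiableAt ℝ (fderiv ℝ (f : (Fin n → ℝ) → ℂ)) x :=
      (((smooth_contDiff f).fderiv_right (m := ∞) (by simp)).differentiable (by simp)) x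
    have h1 : HasFDerivAt (fun y => fderiv ℝ (f : (Fin n → ℝ) → ℂ) y (Pi.single b 1))
        ((fderiv ℝ (fderiv ℝ (f : (Fin n → ℝ) → ℂ)) x).flip (Pi.single b 1)) x := by
      simpa using hd.hasFDerivAt.clm_apply (hasFDerivAt_const (Pi.single b (1 : ℝ)) x)
    have h2 := h1.const_mul (1 / Complex.I)
    rw [dOp_apply]
    congr 1
    change fderiv ℝ (fun y => (1 / Complex.I) *
      fderiv ℝ (f : (Fin n → ℝ) → ℂ) y (Pi.single b 1)) x (Pi.single a 1) = _
    rw [h2.fderiv]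
    simp
  ext f x
  rw [Module.End.mul_apply, Module.End.mul_apply, key, key]
  have hs : IsSymmSndFDerivAt ℝ (f : (Fin n → ℝ) → ℂ) x :=
    (smooth_contDiff f).contDiffAt.isSymmSndFDerivAt (by simp; exact WithTop.coe_le_coe.2 le_top)
  rw [hs.eq]

theorem dOp_range_comm (S : Module.End ℂ (smooth n)) (hS : S ∈ Set.range (dOp (n := n)))
    (T : Module.End ℂ (smooth n)) (hT : T ∈ Set.range (dOp (n := n))) : S * T = T * S := by
  obtain ⟨j, rfl⟩ := hS
  obtain ⟨k, rfl⟩ := hT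
  exact dOp_comm j k

/-- The ring homomorphism from `𝒟` to the endomorphisms of `C^∞(ℝⁿ)` that substitutes the
(commuting) operators `D_j` for the indeterminates. -/
def diffAct (n : ℕ) : DiffRing n →ₐ[ℂ] Module.End ℂ (smooth n) :=
  letI : CommSemiring (Algebra.adjoin ℂ (Set.range (dOp (n := n)))) :=
    { (Algebra.adjoin ℂ (Set.range (dOp (n := n)))).toSemiring with
      mul_comm := (Algebra.isMulCommutative_adjoin ℂ (dOp_range_comm (n := n))).is_comm.comm }
  (Algebra.adjoin ℂ (Set.range (dOp (n := n)))).val.comp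
    (MvPolynomial.aeval (S₁ := Algebra.adjoin ℂ (Set.range (dOp (n := n))))
      fun j => ⟨dOp j, Algebra.subset_adjoin ⟨j, rfl⟩⟩)

/-- `C^∞(ℝⁿ)` as a `𝒟`-module. -/
instance smoothModule : Module (DiffRing n) (smooth n) :=
  Module.compHom (smooth n) (diffAct n).toRingHom

theorem smul_def (r : DiffRing n) (f : smooth n) : r • f = diffAct n r f := rfl

theorem X_smul (j : Fin n) (f : smooth n) : (MvPolynomial.X j : DiffRing n) • f = dOp j f := by
  simp [smul_def, diffAct]

theorem C_smul (c : ℂ) (f : smooth n) : (MvPolynomial.C c : DiffRing n) • f = c • f := by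
  have h : diffAct n (MvPolynomial.C c) = algebraMap ℂ _ c := (diffAct n).commutes c
  rw [smul_def, h]
  rfl

/-- The coordinate function `x_j` on `ℝⁿ`. -/
def coordFn (j : Fin n) : smooth n :=
  ⟨fun x => (x j : ℂ), (Complex.ofRealCLM.contDiff.comp (contDiff_apply ℝ ℝ j) :
    ContDiff ℝ ∞ fun x : Fin n → ℝ => (x j : ℂ))⟩

/-- The exponential `x ↦ e^{i⟨a,x⟩}` with frequency `a ∈ ℚⁿ`. -/
def expFn (a : Fin n → ℚ) : (Fin n → ℝ) → ℂ :=
  fun x => Complex.exp (Complex.I * ∑ j, (a j : ℂ) * (x j : ℂ))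

/-- `C^∞` of the protorus `lim ℝⁿ/2πNℤⁿ`: the smooth functions on `ℝⁿ` that are periodic with
respect to the lattice `2πNℤⁿ` for some integer `N ≥ 1` (depending on the function). -/
def protorus (n : ℕ) : Set (smooth n) :=
  {f | ∃ N : ℕ, 1 ≤ N ∧ ∀ (x : Fin n → ℝ) (k : Fin n → ℤ),
    (f : (Fin n → ℝ) → ℂ) (x + fun j => 2 * Real.pi * (N : ℝ) * (k j : ℝ)) =
      (f : (Fin n → ℝ) → ℂ) x}

/-- The elements of `C^∞` of the protorus whose Fourier expansion `∑ c_a e^{i⟨a,x⟩}`, `a ∈ ℚⁿ`,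
is a finite sum. -/
def protorusFin (n : ℕ) : Set (smooth n) :=
  {f | f ∈ protorus n ∧ ∃ c : (Fin n → ℚ) →₀ ℂ, ∀ x : Fin n → ℝ,
    (f : (Fin n → ℝ) → ℂ) x = c.sum fun a z => z * expFn a x}

/-- The algebra obtained by adjoining the coordinate functions `x₁, …, xₙ` to `protorusFin n`
inside `C^∞(ℝⁿ)`. -/
def signalAlgebra (n : ℕ) : Subalgebra ℂ (smooth n) :=
  Algebra.adjoin ℂ (protorusFin n ∪ Set.range coordFn)

theorem dOp_protorus (j : Fin n) {f : smooth n} (hf : f ∈ protorus n) :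
    dOp j f ∈ protorus n := by
  obtain ⟨N, hN, h⟩ := hf
  refine ⟨N, hN, fun x k => ?_⟩
  rw [dOp_apply, dOp_apply, ← fderiv_comp_add_right]
  congr 3
  funext y
  exact h y k

theorem fderiv_expFn (a : Fin n → ℚ) (x : Fin n → ℝ) (j : Fin n) :
    DifferentiableAt ℝ (expFn a) x ∧
      fderiv ℝ (expFn a) x (Pi.single j 1) = Complex.I * (a j : ℂ) * expFn a x := by
  have hc : ∀ k : Fin n, HasFDerivAt (fun y : Fin n → ℝ => ((y k : ℝ) : ℂ))
      (Complex.ofRealCLM.comp (ContinuousLinearMap.proj (R := ℝ) (φ := fun _ : Fin n => ℝ) k))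
      x := fun k =>
    (Complex.ofRealCLM.comp
      (ContinuousLinearMap.proj (R := ℝ) (φ := fun _ : Fin n => ℝ) k)).hasFDerivAt
  have hs := HasFDerivAt.fun_sum (u := Finset.univ) fun k _ => (hc k).const_mul (a k : ℂ)
  have he := (hs.const_mul Complex.I).cexp
  refine ⟨he.differentiableAt, ?_⟩
  have hE : fderiv ℝ (expFn a) x = _ := he.fderiv
  have hsum : (∑ k, (a k : ℂ) • Complex.ofRealCLM.comp
      (ContinuousLinearMap.proj (R := ℝ) (φ := fun _ : Fin n => ℝ) k)) (Pi.single j 1) =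
      (a j : ℂ) := by
    rw [sum_apply, Finset.sum_eq_single j]
    · simp
    · intro b _ hb
      simp [hb]
    · simp
  rw [hE, smul_apply, smul_apply, hsum, smul_eq_mul, smul_eq_mul, expFn]
  ring

theorem dOp_protorusFin (j : Fin n) {f : smooth n} (hf : f ∈ protorusFin n) :
    dOp j f ∈ protorusFin n := by
  obtain ⟨hp, c, hc⟩ := hf
  refine ⟨dOp_protorus j hp, Finsupp.onFinset c.support (fun a => (a j : ℂ) * c a)
    (fun a ha => Finsupp.mem_support_iff.2 (right_ne_zero_of_mul ha)), fun x => ?_⟩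
  have hf : (f : (Fin n → ℝ) → ℂ) = fun x => ∑ a ∈ c.support, c a * expFn a x := funext hc
  rw [Finsupp.onFinset_sum _ (fun a => by simp), dOp_apply, hf,
    fderiv_fun_sum fun a _ => (fderiv_expFn a x j).1.const_mul (c a),
    sum_apply, Finset.mul_sum]
  refine Finset.sum_congr rfl fun a _ => ?_
  rw [fderiv_const_mul (fderiv_expFn a x j).1, smul_apply,
    (fderiv_expFn a x j).2, smul_eq_mul]
  field_simp

theorem dOp_coordFn (j k : Fin n) :
    dOp j (coordFn k) = algebraMap ℂ (smooth n) (if k = j then 1 / Complex.I else 0) := by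
  ext x
  have hk : HasFDerivAt (fun y : Fin n → ℝ => ((y k : ℝ) : ℂ))
      (Complex.ofRealCLM.comp (ContinuousLinearMap.proj (R := ℝ) (φ := fun _ : Fin n => ℝ) k))
      x := (Complex.ofRealCLM.comp
      (ContinuousLinearMap.proj (R := ℝ) (φ := fun _ : Fin n => ℝ) k)).hasFDerivAt
  change _ * fderiv ℝ (fun y : Fin n → ℝ => ((y k : ℝ) : ℂ)) x (Pi.single j 1) =
    (if k = j then 1 / Complex.I else 0)
  rw [hk.fderiv]
  by_cases h : k = j
  · subst h
    simp
  · simp [h]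

theorem dOp_signalAlgebra (j : Fin n) {f : smooth n} (hf : f ∈ signalAlgebra n) :
    dOp j f ∈ signalAlgebra n := by
  refine Algebra.adjoin_induction (p := fun f _ => dOp j f ∈ signalAlgebra n)
    ?_ ?_ ?_ ?_ hf
  · rintro g (hg | ⟨k, rfl⟩)
    · exact Algebra.subset_adjoin (Or.inl (dOp_protorusFin j hg))
    · rw [dOp_coordFn]
      exact Subalgebra.algebraMap_mem _ _
  · intro c
    have h1 : dOp j (1 : smooth n) = 0 := by
      have h := dOp_mul j (1 : smooth n) 1
      simpa using h
    rw [Algebra.algebraMap_eq_smul_one, map_smul, h1, smul_zero]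
    exact Subalgebra.zero_mem _
  · intro g h _ _ hg hh
    rw [map_add]
    exact Subalgebra.add_mem _ hg hh
  · intro g h hgm hhm hg hh
    rw [dOp_mul]
    exact Subalgebra.add_mem _ (Subalgebra.mul_mem _ hgm hh) (Subalgebra.mul_mem _ hg hhm)

/-- The signal space `ℱ`: the algebra `signalAlgebra n`, as a `𝒟`-submodule of `C^∞(ℝⁿ)`. -/
def signalSpace (n : ℕ) : Submodule (DiffRing n) (smooth n) where
  carrier := {f | f ∈ signalAlgebra n}
  add_mem' hf hg := (signalAlgebra n).add_mem hf hg
  zero_mem' := (signalAlgebra n).zero_mem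
  smul_mem' r f hf := by
    change r • f ∈ signalAlgebra n
    induction r using MvPolynomial.induction_on generalizing f with
    | C c =>
      rw [C_smul]
      exact Subalgebra.smul_mem _ hf c
    | add p q hp hq =>
      rw [add_smul]
      exact Subalgebra.add_mem _ (hp f hf) (hq f hf)
    | mul_X p j hp =>
      rw [mul_smul, X_smul]
      exact hp _ (dOp_signalAlgebra j hf)

instance signalAddCommGroup : AddCommGroup (signalSpace n) :=
  Submodule.addCommGroup (signalSpace n)

instance signalModule : Module (DiffRing n) (signalSpace n) :=
  Submodule.module (signalSpace n)

instance signalSMul : SMul (DiffRing n) (signalSpace n) :=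
  signalModule.toSMul

/-- The behavior `M^⊥ ⊆ ℱ^q` of a submodule `M ⊆ 𝒟^q`: all `(f₁, …, f_q)` with
`∑ r_j f_j = 0` for every `(r₁, …, r_q) ∈ M`. -/
def behavior {q : ℕ} (M : Submodule (DiffRing n) (Fin q → DiffRing n)) :
    Submodule (DiffRing n) (Fin q → signalSpace n) where
  carrier := {f | ∀ r ∈ M, ∑ j, r j • f j = 0}
  add_mem' {f g} hf hg r hr := by
    simp only [Pi.add_apply, smul_add, Finset.sum_add_distrib, hf r hr, hg r hr, add_zero]
  zero_mem' r _ := by simp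
  smul_mem' s f hf r hr := by
    simp only [Pi.smul_apply, smul_comm _ s, ← Finset.smul_sum, hf r hr, smul_zero]

/-- The morphism `L(D) : ℱ^p → ℱ^q`, `g ↦ (∑ k, L_{jk} g_k)_j`, of a `q × p` matrix `L` with
entries in `𝒟`. -/
def matrixOp {p q : ℕ} (L : Matrix (Fin q) (Fin p) (DiffRing n)) :
    (Fin p → signalSpace n) →ₗ[DiffRing n] (Fin q → signalSpace n) where
  toFun g j := ∑ k, L j k • g k
  map_add' g h := by
    funext j
    simp [smul_add, Finset.sum_add_distrib]
  map_smul' s g := by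
    funext j
    simp only [Pi.smul_apply, smul_comm _ s, ← Finset.smul_sum, RingHom.id_apply]

/-- The variety of an ideal of `𝒟` contains a rational point. -/
def HasRationalPoint (P : Ideal (DiffRing n)) : Prop :=
  ∃ a : Fin n → ℚ, (fun j => (a j : ℂ)) ∈ MvPolynomial.zeroLocus ℂ P

end PeriodicBehavior

end

noncomputable section

namespace PeriodicBehavior

open MvPolynomial

variable {n : ℕ}

/-! ### The action of differential operators on exponentials and divided monomials -/

/-! The signal space is an injective `𝒟`-module in which rational points are the only visible ones.
Each signal is killed by a product of maximal ideals of rational points (`IsTame.of_mem`), so each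
nonzero signal has an exponential `e_a`, `a ∈ ℚⁿ`, among its multiples (`exists_smul_eq_expSignal`).
The pairing `(r, f) ↦ (r f)(0)` identifies signals with the functionals on `𝒟` vanishing on such a
product (`eq_zero_of_evalZero`, `exists_functional_eq`); with Artin–Rees this gives Baer's criterion
(`signalSpace_baer`).

An image `L(D) ℱ^p` is the behavior of the left kernel of `L`, and this kernel has torsion-free
quotient. So `M^⊥` is an image exactly when it is also annihilated by every `r` with `d r ∈ M`, `d ≠
0`. If a nonzero associated prime `P = Ann(r₀ mod M)` has a rational zero `a`, injectivity extends
`r₀ ↦ e_a` to an element `f` of `M^⊥` with `r₀ f = e_a ≠ 0`, although `r₀` is torsion modulo `M`.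
Conversely, if a torsion element `r` has `r f ≠ 0` for some `f ∈ M^⊥`, some multiple of `r f` is an
`e_a`; hence `Ann(r mod M)` vanishes at `a`, and so does a nonzero associated prime. -/

instance : IsScalarTower ℂ (DiffRing n) (smooth n) where
  smul_assoc c r f := by rw [smul_def, smul_def, map_smul]; rfl

/-- Evaluation at the origin. -/
def evalZero (n : ℕ) : smooth n →ₗ[ℂ] ℂ where
  toFun f := (f : (Fin n → ℝ) → ℂ) 0
  map_add' _ _ := rfl
  map_smul' _ _ := rfl

theorem evalZero_mul (f g : smooth n) : evalZero n (f * g) = evalZero n f * evalZero n g := rfl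

/-- The operator `D_j` as a derivation of the algebra of smooth functions. -/
def dDer (j : Fin n) : Derivation ℂ (smooth n) (smooth n) :=
  Derivation.mk' (dOp j) fun f g => by
    rw [dOp_mul, smul_eq_mul, smul_eq_mul, mul_comm (dOp j f)]

theorem dOp_one (j : Fin n) : dOp j (1 : smooth n) = 0 :=
  (dDer j).map_one_eq_zero

theorem dOp_pow (j : Fin n) (f : smooth n) (m : ℕ) :
    dOp j (f ^ m) = m • f ^ (m - 1) • dOp j f :=
  (dDer j).leibniz_pow f m

/-- The exponential `x ↦ e^{i⟨a,x⟩}` as a smooth function. -/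
def expSignal (a : Fin n → ℚ) : smooth n :=
  ⟨expFn a, by
    change ContDiff ℝ ∞ fun x : Fin n → ℝ => Complex.exp (Complex.I * ∑ j, (a j : ℂ) * (x j : ℂ))
    refine (contDiff_const.mul (ContDiff.sum fun j _ => contDiff_const.mul ?_)).cexp
    exact smooth_contDiff (coordFn j)⟩

theorem expSignal_apply (a : Fin n → ℚ) (x : Fin n → ℝ) :
    (expSignal a : (Fin n → ℝ) → ℂ) x = expFn a x := rfl

theorem expSignal_zero : expSignal (0 : Fin n → ℚ) = 1 := by
  ext x
  simp [expSignal_apply, expFn]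

theorem expSignal_add (a b : Fin n → ℚ) : expSignal (a + b) = expSignal a * expSignal b := by
  ext x
  change expFn (a + b) x = expFn a x * expFn b x
  simp only [expFn, ← Complex.exp_add, ← mul_add, ← Finset.sum_add_distrib]
  congr 3
  funext j
  simp [add_mul]

theorem evalZero_expSignal (a : Fin n → ℚ) : evalZero n (expSignal a) = 1 := by
  change expFn a 0 = 1
  simp [expFn]

theorem dOp_expSignal (j : Fin n) (a : Fin n → ℚ) :
    dOp j (expSignal a) = (a j : ℂ) • expSignal a := by
  ext x
  rw [dOp_apply]
  change 1 / Complex.I * fderiv ℝ (expFn a) x (Pi.single j 1) = (a j : ℂ) * expFn a x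
  rw [(fderiv_expFn a x j).2]
  field_simp

/-- The substitution `X_j ↦ X_j + a_j`. -/
def shift (a : Fin n → ℚ) : DiffRing n →ₐ[ℂ] DiffRing n :=
  aeval fun j => X j + C (a j : ℂ)

theorem shift_shift_neg (a : Fin n → ℚ) (r : DiffRing n) : shift (-a) (shift a r) = r := by
  have : (shift (-a)).comp (shift a) = AlgHom.id ℂ (DiffRing n) := by
    ext1 j
    simp [shift]
  exact DFunLike.congr_fun this r

/-- Conjugation by an exponential translates symbols, which reduces questions at `a` to the origin.
-/
theorem smul_expSignal_mul (a : Fin n → ℚ) (r : DiffRing n) (f : smooth n) :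
    r • (expSignal a * f) = expSignal a * (shift a r • f) := by
  induction r using MvPolynomial.induction_on generalizing f with
  | C c =>
    have : shift a (C c) = C c := (shift a).commutes c
    rw [this, C_smul, C_smul, mul_smul_comm]
  | add p q hp hq => rw [add_smul, hp, hq, map_add, add_smul, mul_add]
  | mul_X p j hp =>
    have : shift a (X j) = X j + C (a j : ℂ) := by simp [shift]
    rw [mul_smul, X_smul, dOp_mul, dOp_expSignal, smul_mul_assoc, ← mul_smul_comm, ← mul_add, hp,
      map_mul, this, mul_smul, add_smul, X_smul, C_smul]

/-- Evaluation of the symbol of a differential operator at a rational point. -/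
def evalAt (a : Fin n → ℚ) : DiffRing n →ₐ[ℂ] ℂ :=
  aeval fun j => (a j : ℂ)

theorem evalAt_shift (a b : Fin n → ℚ) (r : DiffRing n) :
    evalAt b (shift a r) = evalAt (a + b) r := by
  have : (evalAt b).comp (shift a) = evalAt (a + b) := by
    ext1 j
    simp [shift, evalAt, add_comm]
  exact DFunLike.congr_fun this r

theorem smul_expSignal (a : Fin n → ℚ) (r : DiffRing n) :
    r • expSignal a = evalAt a r • expSignal a := by
  induction r using MvPolynomial.induction_on with
  | C c => simp [C_smul, evalAt]
  | add p q hp hq => rw [add_smul, hp, hq, map_add, add_smul]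
  | mul_X p j hp =>
    rw [mul_comm, mul_smul, hp, ← C_smul, ← mul_smul, mul_comm, mul_smul, X_smul, dOp_expSignal,
      C_smul, smul_smul]
    simp [evalAt, mul_comm]

/-- The ideal of operators whose symbol vanishes at `a`. -/
def pointIdeal (a : Fin n → ℚ) : Ideal (DiffRing n) := RingHom.ker (evalAt a)

theorem mem_pointIdeal {a : Fin n → ℚ} {r : DiffRing n} : r ∈ pointIdeal a ↔ evalAt a r = 0 :=
  Iff.rfl

theorem X_sub_C_mem_pointIdeal (a : Fin n → ℚ) (j : Fin n) :
    X j - C (a j : ℂ) ∈ pointIdeal a := by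
  simp [mem_pointIdeal, evalAt]

theorem isCoprime_pointIdeal {a b : Fin n → ℚ} (h : a ≠ b) :
    IsCoprime (pointIdeal a) (pointIdeal b) := by
  obtain ⟨j, hj⟩ := Function.ne_iff.1 h
  have hne : (b j : ℂ) - (a j : ℂ) ≠ 0 := sub_ne_zero.2 fun h => hj (by exact_mod_cast h.symm)
  -- The difference of `X j - a j` and `X j - b j` is the nonzero constant `b j - a j`; dividing by
  -- it gives `1`.
  refine Ideal.isCoprime_iff_exists.2 ⟨C ((b j : ℂ) - a j)⁻¹ * (X j - C (a j : ℂ)),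
    Ideal.mul_mem_left _ _ (X_sub_C_mem_pointIdeal a j),
    -C ((b j : ℂ) - a j)⁻¹ * (X j - C (b j : ℂ)),
    Ideal.mul_mem_left _ _ (X_sub_C_mem_pointIdeal b j), ?_⟩
  have : C ((b j : ℂ) - a j)⁻¹ * (C (b j : ℂ) - C (a j : ℂ)) = (1 : DiffRing n) := by
    rw [← C_sub, ← C_mul, inv_mul_cancel₀ hne, C_1]
  linear_combination this

/-- The divided power `(i x_j)^m / m!`. -/
def dividedPower (j : Fin n) (m : ℕ) : smooth n :=
  ((m.factorial : ℂ)⁻¹) • (Complex.I • coordFn j) ^ m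

theorem dividedPower_zero (j : Fin n) : dividedPower j 0 = 1 := by
  simp [dividedPower]

theorem dOp_dividedPower_of_ne {j k : Fin n} (h : k ≠ j) (m : ℕ) :
    dOp j (dividedPower k m) = 0 := by
  rw [dividedPower, map_smul, dOp_pow, map_smul, dOp_coordFn, if_neg h]
  simp

theorem dOp_dividedPower_succ (j : Fin n) (m : ℕ) :
    dOp j (dividedPower j (m + 1)) = dividedPower j m := by
  have hI : Complex.I • dOp j (coordFn j) = 1 := by
    rw [dOp_coordFn, if_pos rfl, Algebra.algebraMap_eq_smul_one, smul_smul]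
    simp
  rw [dividedPower, map_smul, dOp_pow, map_smul, hI, dividedPower, Nat.add_sub_cancel, smul_eq_mul,
    mul_one, ← Nat.cast_smul_eq_nsmul ℂ, smul_smul,
    Nat.factorial_succ]
  congr 1
  have := Nat.cast_add_one_ne_zero (R := ℂ) m
  push_cast
  field_simp

theorem evalZero_dividedPower (j : Fin n) (m : ℕ) :
    evalZero n (dividedPower j m) = if m = 0 then 1 else 0 := by
  change (m.factorial : ℂ)⁻¹ * (Complex.I * ((0 : ℝ) : ℂ)) ^ m = _
  by_cases h : m = 0 <;> simp [h]

/-- The divided monomial `∏ (i x_j)^{α_j} / α_j!`. -/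
def dividedMonomial (α : Fin n →₀ ℕ) : smooth n := ∏ j, dividedPower j (α j)

theorem dOp_prod_dividedPower {j : Fin n} (s : Finset (Fin n)) (hj : j ∉ s) (α : Fin n →₀ ℕ) :
    dOp j (∏ k ∈ s, dividedPower k (α k)) = 0 := by
  induction s using Finset.cons_induction with
  | empty => simp [dOp_one]
  | cons k s hk ih =>
    rw [Finset.mem_cons, not_or] at hj
    rw [Finset.prod_cons, dOp_mul, ih hj.2, dOp_dividedPower_of_ne (Ne.symm hj.1), mul_zero,
      zero_mul, add_zero]

theorem dOp_dividedMonomial (j : Fin n) (α : Fin n →₀ ℕ) :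
    dOp j (dividedMonomial α) =
      if j ∈ α.support then dividedMonomial (α - Finsupp.single j 1) else 0 := by
  have key : ∀ β : Fin n →₀ ℕ, dividedMonomial β =
      dividedPower j (β j) * ∏ k ∈ Finset.univ.erase j, dividedPower k (β k) := fun β =>
    (Finset.mul_prod_erase _ _ (Finset.mem_univ j)).symm
  rw [key, dOp_mul, dOp_prod_dividedPower _ (Finset.notMem_erase _ _), mul_zero, zero_add]
  split_ifs with h
  · obtain ⟨m, hm⟩ := Nat.exists_eq_succ_of_ne_zero (Finsupp.mem_support_iff.1 h)
    rw [key (α - _), hm, Nat.succ_eq_add_one, dOp_dividedPower_succ]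
    congr 1
    · simp [hm]
    · refine Finset.prod_congr rfl fun k hk => ?_
      simp [Finsupp.single_eq_of_ne (Finset.ne_of_mem_erase hk)]
  · rw [Finsupp.notMem_support_iff.1 h, dividedPower_zero, dOp_one, zero_mul]

theorem evalZero_dividedMonomial (α : Fin n →₀ ℕ) :
    evalZero n (dividedMonomial α) = if α = 0 then 1 else 0 := by
  have : evalZero n (dividedMonomial α) = ∏ j, evalZero n (dividedPower j (α j)) := by
    rw [dividedMonomial]
    exact map_prod (⟨⟨⟨fun f => evalZero n f, rfl⟩, fun _ _ => rfl⟩, rfl, fun _ _ => rfl⟩ :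
      smooth n →+* ℂ) _ _
  simp only [this, evalZero_dividedPower]
  split_ifs with h
  · simp [h]
  · obtain ⟨j, hj⟩ := Finsupp.ne_iff.1 h
    exact Finset.prod_eq_zero (Finset.mem_univ j) (if_neg hj)

/-- The divided monomials are dual to the monomials of `𝒟`: each `D_j` lowers one exponent by one,
and only the constant survives at the origin. -/
theorem evalZero_smul_dividedMonomial (r : DiffRing n) (α : Fin n →₀ ℕ) :
    evalZero n (r • dividedMonomial α) = coeff α r := by
  induction r using MvPolynomial.induction_on generalizing α with
  | C c =>
    rw [C_smul, map_smul, evalZero_dividedMonomial, coeff_C]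
    simp [eq_comm]
  | add p q hp hq => rw [add_smul, map_add, hp, hq, coeff_add]
  | mul_X p j hp =>
    rw [mul_smul, X_smul, dOp_dividedMonomial, coeff_mul_X']
    split_ifs
    · exact hp _
    · rw [smul_zero, map_zero]

/-! ### Elements of the signal space -/

theorem expSignal_mem_protorus (a : Fin n → ℚ) : expSignal a ∈ protorus n := by
  -- The product of the denominators clears all frequencies at once, so the phase changes by an
  -- integer multiple of `2πi`.
  refine ⟨∏ j, (a j).den, Nat.one_le_iff_ne_zero.2
    (Finset.prod_ne_zero_iff.2 fun j _ => (a j).den_nz), fun x k => ?_⟩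
  have hint : ∀ j, ∃ m : ℤ, (a j : ℂ) * ((∏ l, (a l).den : ℕ) : ℂ) = m := fun j => by
    obtain ⟨d, hd⟩ := Finset.dvd_prod_of_mem (fun l => (a l).den) (Finset.mem_univ j)
    refine ⟨(a j).num * d, ?_⟩
    have h : (a j : ℂ) * ((a j).den : ℂ) = ((a j).num : ℂ) := by
      exact_mod_cast congrArg (fun q : ℚ => (q : ℂ)) (Rat.mul_den_eq_num (a j))
    rw [hd]
    push_cast
    rw [← mul_assoc, h]
  choose m hm using hint
  rw [expSignal_apply, expSignal_apply, expFn, expFn, Complex.exp_eq_exp_iff_exists_int]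
  refine ⟨∑ j, m j * k j, ?_⟩
  push_cast
  rw [Finset.sum_mul, Finset.mul_sum, Finset.mul_sum, ← Finset.sum_add_distrib]
  refine Finset.sum_congr rfl fun j _ => ?_
  rw [← hm j]
  simp only [Pi.add_apply]
  push_cast
  ring

theorem expSignal_mem (a : Fin n → ℚ) : expSignal a ∈ signalSpace n := by
  change expSignal a ∈ signalAlgebra n
  refine Algebra.subset_adjoin (Or.inl ⟨expSignal_mem_protorus a, Finsupp.single a 1, fun x => ?_⟩)
  rw [Finsupp.sum_single_index (zero_mul _), one_mul, expSignal_apply]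

theorem coordFn_mem (j : Fin n) : coordFn j ∈ signalAlgebra n :=
  Algebra.subset_adjoin (Or.inr ⟨j, rfl⟩)

theorem dividedMonomial_mem (α : Fin n →₀ ℕ) : dividedMonomial α ∈ signalAlgebra n :=
  Subalgebra.prod_mem _ fun j _ => Subalgebra.smul_mem _ (Subalgebra.pow_mem _
    (Subalgebra.smul_mem _ (coordFn_mem j) _) _) _

theorem mem_span_expSignal {f : smooth n} (hf : f ∈ protorusFin n) :
    f ∈ Submodule.span ℂ (Set.range (expSignal (n := n))) := by
  obtain ⟨-, c, hc⟩ := hf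
  have : f = c.sum fun a z => z • expSignal a := by
    ext x
    rw [hc, Finsupp.sum, Finsupp.sum, AddSubmonoidClass.coe_finsetSum, Finset.sum_apply]
    rfl
  rw [this]
  exact Submodule.sum_mem _ fun a _ => Submodule.smul_mem _ _ (Submodule.subset_span ⟨a, rfl⟩)

/-! ### Signals are annihilated by products of ideals of rational points -/

/-- The product of the ideals of a multiset of rational points. -/
def pointProd (s : Multiset (Fin n → ℚ)) : Ideal (DiffRing n) := (s.map pointIdeal).prod

theorem pointProd_add (s t : Multiset (Fin n → ℚ)) :
    pointProd (s + t) = pointProd s * pointProd t := by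
  simp [pointProd]

theorem pointProd_cons (a : Fin n → ℚ) (s : Multiset (Fin n → ℚ)) :
    pointProd (a ::ₘ s) = pointIdeal a * pointProd s := by
  simp [pointProd]

theorem pointProd_nsmul (k : ℕ) (s : Multiset (Fin n → ℚ)) :
    pointProd (k • s) = pointProd s ^ k := by
  simp [pointProd, Multiset.map_nsmul, Multiset.prod_nsmul]

/-- A smooth function is tame if some product of ideals of rational points annihilates it. -/
def IsTame (f : smooth n) : Prop :=
  ∃ s : Multiset (Fin n → ℚ), ∀ r ∈ pointProd s, r • f = 0

theorem IsTame.zero : IsTame (0 : smooth n) := ⟨0, fun _ _ => smul_zero _⟩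

theorem IsTame.add {f g : smooth n} (hf : IsTame f) (hg : IsTame g) : IsTame (f + g) := by
  obtain ⟨s, hs⟩ := hf
  obtain ⟨t, ht⟩ := hg
  refine ⟨s + t, fun r hr => ?_⟩
  rw [pointProd_add] at hr
  have h1 : pointProd s * pointProd t ≤ pointProd s := Ideal.mul_le_left
  have h2 : pointProd s * pointProd t ≤ pointProd t := Ideal.mul_le_right
  rw [smul_add, hs r (h1 hr), ht r (h2 hr), add_zero]

theorem IsTame.const_smul {f : smooth n} (hf : IsTame f) (c : ℂ) : IsTame (c • f) := by
  obtain ⟨s, hs⟩ := hf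
  exact ⟨s, fun r hr => by rw [← C_smul, smul_comm, hs r hr, smul_zero]⟩

theorem IsTame.one : IsTame (1 : smooth n) := by
  refine ⟨{0}, fun r hr => ?_⟩
  have hr : r ∈ pointIdeal 0 := by simpa [pointProd] using hr
  rw [← expSignal_zero, smul_expSignal, mem_pointIdeal.1 hr, zero_smul]

theorem pointProd_le_comap_shift (a : Fin n → ℚ) (s : Multiset (Fin n → ℚ)) :
    pointProd (s.map (a + ·)) ≤ (pointProd s).comap (shift a) := by
  rw [← Ideal.map_le_iff_le_comap]
  induction s using Multiset.induction_on with
  | empty => simp [pointProd]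
  | cons b s ih =>
    rw [Multiset.map_cons, pointProd_cons, pointProd_cons, Ideal.map_mul]
    refine Ideal.mul_mono (Ideal.map_le_iff_le_comap.2 fun r hr => ?_) ih
    rwa [Ideal.mem_comap, mem_pointIdeal, evalAt_shift]

theorem IsTame.expSignal_mul {f : smooth n} (hf : IsTame f) (a : Fin n → ℚ) :
    IsTame (expSignal a * f) := by
  obtain ⟨s, hs⟩ := hf
  refine ⟨s.map (a + ·), fun r hr => ?_⟩
  rw [smul_expSignal_mul, hs _ (pointProd_le_comap_shift a s hr), mul_zero]

/-- The commutator of `r` with multiplication by `x_j` is `(1/i) ∂r/∂X_j`. -/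
theorem smul_coordFn_mul (j : Fin n) (r : DiffRing n) (f : smooth n) :
    r • (coordFn j * f) = coordFn j * (r • f) + (1 / Complex.I) • (pderiv j r • f) := by
  induction r using MvPolynomial.induction_on generalizing f with
  | C c => rw [C_smul, C_smul, mul_smul_comm, pderiv_C, zero_smul, smul_zero, add_zero]
  | add p q hp hq =>
    rw [add_smul, hp, hq, map_add, add_smul, add_smul, mul_add, smul_add]
    abel
  | mul_X p k hp =>
    have hk : dOp k (coordFn j) =
        (1 / Complex.I) • (pderiv j (X k : DiffRing n) • (1 : smooth n)) := by
      rw [dOp_coordFn, pderiv_X, Algebra.algebraMap_eq_smul_one]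
      by_cases h : j = k
      · simp [h]
      · simp [h]
    have hk' : dOp k (coordFn j) * f = (1 / Complex.I) • (pderiv j (X k : DiffRing n) • f) := by
      rw [hk, smul_mul_assoc, pderiv_X]
      by_cases h : k = j
      · simp [h]
      · simp [h]
    rw [mul_smul, X_smul, dOp_mul, hk', smul_add, hp, Derivation.leibniz, mul_smul, X_smul,
      smul_eq_mul, smul_eq_mul, add_smul, smul_add, mul_comm (X k), mul_smul (pderiv j p), X_smul,
      ← C_smul, smul_comm p, mul_smul p]
    abel

theorem IsTame.coordFn_mul {f : smooth n} (hf : IsTame f) (j : Fin n) :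
    IsTame (coordFn j * f) := by
  obtain ⟨s, hs⟩ := hf
  -- For `p`, `q` in the product ideal killing `f`, `q` reduces `x_j f` to a multiple of `(∂q/∂X_j)
  -- f`, which `p` then kills. Hence doubling suffices.
  refine ⟨s + s, fun r hr => ?_⟩
  rw [pointProd_add] at hr
  refine Submodule.mul_induction_on hr (fun p hp q hq => ?_) fun p q hp hq => ?_
  · rw [mul_smul, smul_coordFn_mul, hs q hq, mul_zero, zero_add, ← C_smul, smul_comm p,
      smul_comm p, hs p hp, smul_zero, smul_zero]
  · rw [add_smul, hp, hq, add_zero]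

theorem IsTame.of_mem {f : smooth n} (hf : f ∈ signalAlgebra n) : IsTame f := by
  rw [signalAlgebra, ← Subalgebra.mem_toSubmodule, Algebra.adjoin_eq_span] at hf
  refine Submodule.span_induction (fun g hg => ?_) IsTame.zero (fun _ _ _ _ => IsTame.add)
    (fun c _ _ h => h.const_smul c) hf
  -- The algebra is spanned by words in the generators, so it is enough that left multiplication by
  -- one generator preserves tameness.
  refine Submonoid.closure_induction_left IsTame.one (fun u hu g _ hg => ?_) hg
  rcases hu with hu | ⟨j, rfl⟩
  · refine Submodule.span_induction (p := fun u _ => IsTame (u * g)) ?_ ?_ ?_ ?_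
      (mem_span_expSignal hu)
    · rintro _ ⟨a, rfl⟩
      exact hg.expSignal_mul a
    · rw [zero_mul]
      exact IsTame.zero
    · intro u v _ _ hu hv
      rw [add_mul]
      exact hu.add hv
    · intro c u _ hu
      rw [smul_mul_assoc]
      exact hu.const_smul c
  · exact hg.coordFn_mul j

/-! ### Exponentials among the multiples of a signal -/

theorem eq_smul_expSignal_of_dOp {f : smooth n} {a : Fin n → ℚ}
    (h : ∀ j, dOp j f = (a j : ℂ) • f) : ∃ c : ℂ, f = c • expSignal a := by
  set g := expSignal (-a) * f with hg
  have hinv : expSignal a * g = f := by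
    rw [hg, ← mul_assoc, ← expSignal_add, add_neg_cancel, expSignal_zero, one_mul]
  have hd : ∀ j, dOp j g = 0 := fun j => by
    rw [hg, dOp_mul, h, dOp_expSignal, mul_smul_comm, smul_mul_assoc, ← add_smul]
    simp
  have hfd : ∀ x, fderiv ℝ (g : (Fin n → ℝ) → ℂ) x = 0 := fun x => by
    ext v
    rw [← Finset.univ_sum_single v, map_sum, map_sum]
    refine Finset.sum_congr rfl fun j _ => ?_
    have hx : (dOp j g : (Fin n → ℝ) → ℂ) x = 0 := by rw [hd j]; rfl
    rw [dOp_apply] at hx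
    have h0 : fderiv ℝ (g : (Fin n → ℝ) → ℂ) x (Pi.single j 1) = 0 := by simpa using hx
    have : (Pi.single j (v j) : Fin n → ℝ) = v j • Pi.single j 1 := by
      rw [← Pi.single_smul, smul_eq_mul, mul_one]
    rw [this, map_smul, h0]
    simp
  refine ⟨evalZero n g, ?_⟩
  rw [← hinv]
  have hc : g = evalZero n g • 1 := by
    ext x
    have := is_const_of_fderiv_eq_zero (smooth_differentiable g) hfd x 0
    rw [this]
    exact (mul_one _).symm
  conv_lhs => rw [hc]
  rw [mul_smul_comm, mul_one]

theorem exists_smul_eq_expSignal_of_pointProd (s : Multiset (Fin n → ℚ)) {f : smooth n}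
    (hf : f ≠ 0) (h : ∀ r ∈ pointProd s, r • f = 0) :
    ∃ (r : DiffRing n) (a : Fin n → ℚ), r • f = expSignal a := by
  induction s using Multiset.induction_on with
  | empty => exact absurd (by simpa using h 1 (by simp [pointProd])) hf
  | cons a s ih =>
    -- If the shorter product does not kill `f`, some nonzero `r f` is killed by the ideal of `a`.
    -- It is then a joint eigenfunction of the `D_j`, that is, a multiple of `e_a`.
    by_cases h0 : ∀ r ∈ pointProd s, r • f = 0
    · exact ih h0
    push Not at h0
    obtain ⟨r, hr, hrf⟩ := h0
    obtain ⟨c, hc⟩ : ∃ c : ℂ, r • f = c • expSignal a := by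
      refine eq_smul_expSignal_of_dOp fun j => ?_
      have := h ((X j - C (a j : ℂ)) * r) (by
        rw [pointProd_cons]
        exact Ideal.mul_mem_mul (X_sub_C_mem_pointIdeal a j) hr)
      rw [mul_smul, sub_smul, X_smul, C_smul] at this
      exact sub_eq_zero.1 this
    have hc0 : c ≠ 0 := fun h => hrf (by rw [hc, h, zero_smul])
    exact ⟨C c⁻¹ * r, a, by rw [mul_smul, hc, C_smul, inv_smul_smul₀ hc0]⟩

/-- Every nonzero signal generates a submodule containing an exponential. -/
theorem exists_smul_eq_expSignal {f : smooth n} (hf : f ∈ signalAlgebra n) (h0 : f ≠ 0) :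
    ∃ (r : DiffRing n) (a : Fin n → ℚ), r • f = expSignal a := by
  obtain ⟨s, hs⟩ := IsTame.of_mem hf
  exact exists_smul_eq_expSignal_of_pointProd s h0 hs

/-- A signal is determined by its functional: a nonzero one has an exponential among its multiples,
whose value at the origin is `1`. -/
theorem eq_zero_of_evalZero {f : smooth n} (hf : f ∈ signalAlgebra n)
    (h : ∀ r : DiffRing n, evalZero n (r • f) = 0) : f = 0 := by
  by_contra h0
  obtain ⟨r, a, hr⟩ := exists_smul_eq_expSignal hf h0
  have := h r
  rw [hr, evalZero_expSignal] at this
  exact one_ne_zero this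

/-! ### Representation of functionals and injectivity of the signal space -/

/-- The functional `r ↦ (r f)(0)` on differential operators. -/
def functional (f : smooth n) : DiffRing n →ₗ[ℂ] ℂ where
  toFun r := evalZero n (r • f)
  map_add' r s := by rw [add_smul, map_add]
  map_smul' c r := by rw [smul_assoc, map_smul, RingHom.id_apply]

theorem functional_apply (f : smooth n) (r : DiffRing n) :
    functional f r = evalZero n (r • f) := rfl

theorem functional_add (f g : smooth n) : functional (f + g) = functional f + functional g := by
  refine LinearMap.ext fun r => ?_
  rw [LinearMap.add_apply, functional_apply, smul_add, map_add]
  rfl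

theorem exists_functional_eq_of_pow_idealOfVars (k : ℕ) (μ : DiffRing n →ₗ[ℂ] ℂ)
    (h : ∀ r ∈ idealOfVars (Fin n) ℂ ^ k, μ r = 0) :
    ∃ f ∈ signalAlgebra n, functional f = μ := by
  classical
  -- Degrees below `k` would suffice; in degree `k` the coefficients `μ (monomial α 1)` vanish.
  set S : Finset (Fin n →₀ ℕ) := (Finsupp.finite_of_degree_le (σ := Fin n) k).toFinset
  refine ⟨∑ α ∈ S, μ (monomial α 1) • dividedMonomial α,
    Subalgebra.sum_mem _ fun α _ => Subalgebra.smul_mem _ (dividedMonomial_mem α) _, ?_⟩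
  refine LinearMap.ext fun r => ?_
  have key : ∀ β (c : ℂ), functional (∑ α ∈ S, μ (monomial α 1) • dividedMonomial α)
      (monomial β c) = μ (monomial β c) := fun β c => by
    have h1 : functional (∑ α ∈ S, μ (monomial α 1) • dividedMonomial α) (monomial β c) =
        ∑ α ∈ S, μ (monomial α 1) * coeff α (monomial β c) := by
      rw [functional_apply, Finset.smul_sum, map_sum]
      refine Finset.sum_congr rfl fun α _ => ?_
      rw [← C_smul, smul_comm, C_smul, map_smul, evalZero_smul_dividedMonomial, smul_eq_mul]
    have h2 : μ (monomial β c) = c * μ (monomial β 1) := by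
      rw [← smul_eq_mul, ← map_smul, smul_monomial, smul_eq_mul, mul_one]
    rw [h1, h2]
    simp only [coeff_monomial, mul_ite, mul_zero, Finset.sum_ite_eq]
    split_ifs with hβ
    · exact mul_comm _ _
    · have hk : k ≤ β.degree := by
        by_contra hlt
        exact hβ ((Set.Finite.mem_toFinset _).2 (not_le.1 hlt).le)
      rw [h _ ((monomial_mem_pow_idealOfVars_iff k β one_ne_zero).2 hk), mul_zero]
  induction r using MvPolynomial.induction_on' with
  | monomial β c => exact key β c
  | add p q hp hq => rw [map_add, map_add, hp, hq]

theorem exists_functional_eq_of_pow_pointIdeal (a : Fin n → ℚ) (k : ℕ) (μ : DiffRing n →ₗ[ℂ] ℂ)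
    (h : ∀ r ∈ pointIdeal a ^ k, μ r = 0) : ∃ f ∈ signalAlgebra n, functional f = μ := by
  obtain ⟨f, hf, hμ⟩ := exists_functional_eq_of_pow_idealOfVars k
    (μ.comp (shift (-a)).toLinearMap) fun r hr => by
      refine h _ ?_
      have hle : Ideal.map (shift (-a)) (idealOfVars (Fin n) ℂ) ≤ pointIdeal a := by
        rw [Ideal.map_le_iff_le_comap, idealOfVars, Ideal.span_le]
        rintro _ ⟨j, rfl⟩
        change shift (-a) (X j) ∈ pointIdeal a
        rw [mem_pointIdeal, evalAt_shift, neg_add_cancel]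
        simp [evalAt]
      refine Ideal.pow_right_mono hle k ?_
      rw [← Ideal.map_pow]
      exact Ideal.mem_map_of_mem _ hr
  refine ⟨expSignal a * f, Subalgebra.mul_mem _ (expSignal_mem a) hf, ?_⟩
  refine LinearMap.ext fun r => ?_
  have := DFunLike.congr_fun hμ (shift a r)
  rw [functional_apply, smul_expSignal_mul, evalZero_mul, evalZero_expSignal, one_mul,
    ← functional_apply, this]
  simp [shift_shift_neg]

/-- Chinese remaindering: with `u + v = 1` from coprimality, `μ = μ(u ·) + μ(v ·)` splits off the
part supported at one point. -/
theorem exists_functional_eq_of_prod (A : Finset (Fin n → ℚ)) (e : (Fin n → ℚ) → ℕ)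
    (μ : DiffRing n →ₗ[ℂ] ℂ) (h : ∀ r ∈ ∏ a ∈ A, pointIdeal a ^ e a, μ r = 0) :
    ∃ f ∈ signalAlgebra n, functional f = μ := by
  induction A using Finset.cons_induction generalizing μ with
  | empty =>
    refine ⟨0, Subalgebra.zero_mem _, ?_⟩
    refine LinearMap.ext fun r => ?_
    rw [h r (by simp), functional_apply, smul_zero, map_zero]
  | cons a A ha ih =>
    rw [Finset.prod_cons] at h
    have hco : IsCoprime (pointIdeal a ^ e a) (∏ b ∈ A, pointIdeal b ^ e b) :=
      IsCoprime.prod_right fun b hb =>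
        (isCoprime_pointIdeal (ne_of_mem_of_not_mem hb ha).symm).pow
    obtain ⟨u, hu, v, hv, huv⟩ := Ideal.isCoprime_iff_exists.1 hco
    obtain ⟨f, hf, hfμ⟩ := ih (μ.comp (LinearMap.mulLeft ℂ u)) fun r hr =>
      h _ (Ideal.mul_mem_mul hu hr)
    obtain ⟨g, hg, hgμ⟩ := exists_functional_eq_of_pow_pointIdeal a (e a)
      (μ.comp (LinearMap.mulLeft ℂ v)) fun r hr => h _ (by
        change v * r ∈ _
        rw [mul_comm v]
        exact Ideal.mul_mem_mul hr hv)
    refine ⟨f + g, Subalgebra.add_mem _ hf hg, ?_⟩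
    refine LinearMap.ext fun r => ?_
    rw [functional_add, hfμ, hgμ]
    change μ (u * r) + μ (v * r) = μ r
    rw [← map_add, ← add_mul, huv, one_mul]

/-- Every functional on `𝒟` vanishing on a product of ideals of rational points is of the form
`r ↦ (r f)(0)` for some signal `f`. -/
theorem exists_functional_eq (s : Multiset (Fin n → ℚ)) (μ : DiffRing n →ₗ[ℂ] ℂ)
    (h : ∀ r ∈ pointProd s, μ r = 0) : ∃ f ∈ signalAlgebra n, functional f = μ := by
  classical
  refine exists_functional_eq_of_prod s.toFinset (fun a => s.count a) μ fun r hr => h r ?_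
  rwa [pointProd, Finset.prod_multiset_map_count]

theorem pointProd_anti {s t : Multiset (Fin n → ℚ)} (h : s ≤ t) : pointProd t ≤ pointProd s := by
  obtain ⟨u, rfl⟩ := Multiset.le_iff_exists_add.1 h
  rw [pointProd_add]
  exact Ideal.mul_le_left

/-! ### Injectivity by Baer's criterion -/

theorem exists_pointProd_smul_eq_zero {N : Type*} [AddCommGroup N] [Module (DiffRing n) N]
    [Module.Finite (DiffRing n) N] (φ : N →ₗ[DiffRing n] signalSpace n) :
    ∃ s : Multiset (Fin n → ℚ), ∀ r ∈ pointProd s, ∀ x, r • φ x = 0 := by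
  obtain ⟨m, v, hv⟩ := Module.Finite.exists_fin (R := DiffRing n) (M := N)
  choose s hs using fun i => IsTame.of_mem (φ (v i)).2
  refine ⟨∑ i, s i, fun r hr x => ?_⟩
  have hx : x ∈ Submodule.span (DiffRing n) (Set.range v) := hv ▸ Submodule.mem_top
  induction hx using Submodule.span_induction with
  | mem x hx =>
    obtain ⟨i, rfl⟩ := hx
    exact Subtype.ext (hs i r (pointProd_anti (Finset.single_le_sum
      (f := s) (fun _ _ => Multiset.zero_le _) (Finset.mem_univ i)) hr))
  | zero => rw [map_zero, smul_zero]
  | add x y _ _ hx hy => rw [map_add, smul_add, hx, hy, add_zero]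
  | smul c x _ hx => rw [map_smul, smul_comm, hx, smul_zero]

theorem signalSpace_baer : Module.Baer (DiffRing n) (signalSpace n) := by
  intro J φ
  obtain ⟨s, hs⟩ := exists_pointProd_smul_eq_zero φ
  -- Artin–Rees: with `I = pointProd s`, `I^(k+1) ∩ J = I (I^k ∩ J) ⊆ I J`, and `φ` vanishes on `I
  -- J`.
  obtain ⟨k, hk⟩ := Ideal.exists_pow_inf_eq_pow_smul (pointProd s) J
  have hkill : ∀ (x : DiffRing n) (hx : x ∈ J), x ∈ pointProd s ^ (k + 1) → φ ⟨x, hx⟩ = 0 := by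
    intro x hx hxk
    have hmem : x ∈ pointProd s ^ (k + 1) • (⊤ : Submodule (DiffRing n) (DiffRing n)) ⊓ J :=
      ⟨by simpa using hxk, hx⟩
    rw [hk (k + 1) (Nat.le_succ k), Nat.add_sub_cancel_left, pow_one] at hmem
    obtain ⟨_, h⟩ : ∃ h : x ∈ J, φ ⟨x, h⟩ = 0 := by
      refine Submodule.smul_induction_on hmem (fun r hr y hy => ?_) ?_
      · refine ⟨J.mul_mem_left r hy.2, ?_⟩
        rw [← hs r hr ⟨y, hy.2⟩, ← map_smul]
        rfl
      · rintro y z ⟨hy, hy0⟩ ⟨hz, hz0⟩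
        refine ⟨J.add_mem hy hz, ?_⟩
        rw [← add_zero (0 : signalSpace n)]
        nth_rw 1 [← hy0]
        rw [← hz0, ← map_add]
        rfl
    exact h
  set I : Submodule ℂ (DiffRing n) := (pointProd s ^ (k + 1)).restrictScalars ℂ
  let ν : J.restrictScalars ℂ →ₗ[ℂ] ℂ :=
    { toFun := fun x => evalZero n (φ ⟨x.1, x.2⟩ : signalSpace n)
      map_add' := fun x y => by
        rw [← map_add, ← Submodule.coe_add, ← map_add]
        rfl
      map_smul' := fun c x => by
        rw [RingHom.id_apply, ← map_smul, ← C_smul, ← Submodule.coe_smul, ← map_smul]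
        congr 3
        exact Subtype.ext (smul_eq_C_mul _ _) }
  let ι : J.restrictScalars ℂ →ₗ[ℂ] DiffRing n ⧸ I := I.mkQ.comp (J.restrictScalars ℂ).subtype
  -- Since `ν` vanishes on `J ∩ I`, it extends linearly over `ℂ` from the image of `J` to all of `𝒟
  -- / I`. The extension pulls back to a functional represented by a signal `f`.
  have hν : ν ∈ LinearMap.range ι.dualMap := by
    rw [LinearMap.range_dualMap_eq_dualAnnihilator_ker, Submodule.mem_dualAnnihilator]
    intro x hx
    have hxI : x.1 ∈ I := (Submodule.Quotient.mk_eq_zero _).1 (LinearMap.mem_ker.1 hx)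
    change evalZero n (φ ⟨x.1, x.2⟩ : signalSpace n) = 0
    rw [hkill x.1 x.2 hxI]
    exact map_zero _
  obtain ⟨μ, hμ⟩ := hν
  obtain ⟨f, hf, hfμ⟩ := exists_functional_eq ((k + 1) • s) (μ.comp I.mkQ) fun r hr => by
    rw [pointProd_nsmul] at hr
    rw [LinearMap.comp_apply, Submodule.mkQ_apply, (Submodule.Quotient.mk_eq_zero I).2 hr, map_zero]
  refine ⟨LinearMap.toSpanSingleton _ _ (⟨f, hf⟩ : signalSpace n), fun x hx => ?_⟩
  rw [LinearMap.toSpanSingleton_apply, ← sub_eq_zero]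
  -- Agreement of functionals on `J` gives `x f = φ x`, because `r x` stays in `J` for every `r`.
  refine Subtype.ext (eq_zero_of_evalZero
    (Submodule.sub_mem (signalSpace n) ((signalSpace n).smul_mem x hf) (φ ⟨x, hx⟩).2) fun r => ?_)
  have hrx := J.mul_mem_left r hx
  have h1 : evalZero n (r • x • f) = evalZero n (r • (φ ⟨x, hx⟩ : smooth n)) := by
    have h2 := DFunLike.congr_fun hμ ⟨r * x, hrx⟩
    have h3 := DFunLike.congr_fun hfμ (r * x)
    rw [← mul_smul, ← functional_apply, h3, ← Submodule.coe_smul, ← map_smul]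
    exact h2
  change evalZero n (r • (x • f - (φ ⟨x, hx⟩ : smooth n))) = 0
  rw [smul_sub, map_sub, h1, sub_self]

/-- The signal space is an injective `𝒟`-module. -/
theorem signalSpace_injective : Module.Injective (DiffRing n) (signalSpace n) :=
  signalSpace_baer.injective

/-! ### Submodules with torsion-free quotient are kernels of matrices -/

section Torsion

variable {R : Type*} [CommRing R] [IsDomain R] {q : ℕ}

theorem exists_smul_mem_of_mem_span_fractionRing (M : Submodule R (Fin q → R)) (r : Fin q → R)
    (h : (fun j => algebraMap R (FractionRing R) (r j)) ∈ Submodule.span (FractionRing R)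
      ((fun (m : Fin q → R) j => algebraMap R (FractionRing R) (m j)) '' M)) :
    ∃ d : R, d ≠ 0 ∧ d • r ∈ M := by
  have key : ∀ w ∈ Submodule.span (FractionRing R)
      ((fun (m : Fin q → R) j => algebraMap R (FractionRing R) (m j)) '' M),
      ∃ d : R, d ≠ 0 ∧ ∃ m ∈ M, ∀ j, algebraMap R _ d * w j = algebraMap R _ (m j) := by
    intro w hw
    induction hw using Submodule.span_induction with
    | mem w hw =>
      obtain ⟨m, hm, rfl⟩ := hw
      exact ⟨1, one_ne_zero, m, hm, fun j => by simp⟩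
    | zero => exact ⟨1, one_ne_zero, 0, M.zero_mem, fun j => by simp⟩
    | add v w _ _ hv hw =>
      obtain ⟨d, hd, m, hm, h⟩ := hv
      obtain ⟨d', hd', m', hm', h'⟩ := hw
      refine ⟨d * d', mul_ne_zero hd hd', d' • m + d • m',
        M.add_mem (M.smul_mem _ hm) (M.smul_mem _ hm'), fun j => ?_⟩
      simp only [Pi.add_apply, Pi.smul_apply, smul_eq_mul, map_add, map_mul, ← h, ← h']
      ring
    | smul c w _ hw =>
      obtain ⟨d, hd, m, hm, h⟩ := hw
      obtain ⟨x, y, hy, rfl⟩ := IsFractionRing.div_surjective (A := R) c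
      have hy0 := nonZeroDivisors.ne_zero hy
      refine ⟨y * d, mul_ne_zero hy0 hd, x • m, M.smul_mem _ hm, fun j => ?_⟩
      have : algebraMap R (FractionRing R) y ≠ 0 := by simpa using hy0
      simp only [Pi.smul_apply, smul_eq_mul, map_mul, ← h]
      field_simp
  obtain ⟨d, hd, m, hm, h⟩ := key _ h
  refine ⟨d, hd, ?_⟩
  have : d • r = m := funext fun j => IsFractionRing.injective R (FractionRing R) (by
    rw [← h j, Pi.smul_apply, smul_eq_mul, map_mul])
  rwa [this]

/-- Double orthogonality over the fraction field: a linear form separating `r` from the span of `M`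
becomes, after clearing denominators, a vector `v` over `R` orthogonal to `M` but not to `r`. -/
theorem exists_smul_mem_of_dotProduct_eq_zero (M : Submodule R (Fin q → R)) (r : Fin q → R)
    (h : ∀ v : Fin q → R, (∀ m ∈ M, m ⬝ᵥ v = 0) → r ⬝ᵥ v = 0) :
    ∃ d : R, d ≠ 0 ∧ d • r ∈ M := by
  refine exists_smul_mem_of_mem_span_fractionRing M r ?_
  by_contra hr
  obtain ⟨ψ, hψ, hM⟩ := Submodule.exists_dual_map_eq_bot_of_notMem hr inferInstance
  obtain ⟨b, hb⟩ := IsLocalization.exist_integer_multiples_of_finite (nonZeroDivisors R)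
    fun j => ψ fun k => if j = k then 1 else 0
  choose v hv using hb
  have key : ∀ m : Fin q → R, algebraMap R (FractionRing R) (m ⬝ᵥ v) =
      algebraMap R (FractionRing R) b * ψ fun j => algebraMap R _ (m j) := fun m => by
    rw [LinearMap.pi_apply_eq_sum_univ ψ, dotProduct, map_sum, Finset.mul_sum]
    refine Finset.sum_congr rfl fun j _ => ?_
    rw [map_mul, hv, Algebra.smul_def, smul_eq_mul]
    ring
  have hrv := key r
  rw [h v fun m hm => ?_, map_zero] at hrv
  · have hb0 : algebraMap R (FractionRing R) b ≠ 0 := by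
      simp
    exact mul_ne_zero hb0 hψ hrv.symm
  · refine IsFractionRing.injective R (FractionRing R) ?_
    have h0 : ψ (fun j => algebraMap R (FractionRing R) (m j)) ∈ Submodule.map ψ
        (Submodule.span (FractionRing R)
          ((fun (m : Fin q → R) j => algebraMap R (FractionRing R) (m j)) '' M)) :=
      Submodule.mem_map_of_mem (Submodule.subset_span ⟨m, hm, rfl⟩)
    rw [hM, Submodule.mem_bot] at h0
    rw [key, h0, mul_zero, map_zero]

theorem exists_matrix_vecMul_eq_zero_iff [IsNoetherianRing R] (M : Submodule R (Fin q → R)) :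
    ∃ (p : ℕ) (L : Matrix (Fin q) (Fin p) R),
      ∀ r, Matrix.vecMul r L = 0 ↔ ∃ d : R, d ≠ 0 ∧ d • r ∈ M := by
  let V : Submodule R (Fin q → R) :=
    { carrier := {v | ∀ m ∈ M, m ⬝ᵥ v = 0}
      add_mem' := fun hv hw m hm => by rw [dotProduct_add, hv m hm, hw m hm, add_zero]
      zero_mem' := fun m _ => dotProduct_zero m
      smul_mem' := fun c v hv m hm => by rw [dotProduct_smul, hv m hm, smul_zero] }
  -- The columns of `L` are generators of the orthogonal module `V`, so `r L = 0` means that `r` is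
  -- orthogonal to `V`.
  obtain ⟨p, w, hw⟩ := Submodule.fg_iff_exists_fin_generating_family.1 (IsNoetherian.noetherian V)
  refine ⟨p, Matrix.of fun j k => w k j, fun r => ⟨fun h => ?_, fun ⟨d, hd, h⟩ => ?_⟩⟩
  · refine exists_smul_mem_of_dotProduct_eq_zero M r fun v hv => ?_
    have hvw : v ∈ Submodule.span R (Set.range w) := hw ▸ hv
    clear hv
    induction hvw using Submodule.span_induction with
    | mem v hv =>
      obtain ⟨k, rfl⟩ := hv
      exact congrFun h k
    | zero => exact dotProduct_zero r
    | add v v' _ _ hv hv' => rw [dotProduct_add, hv, hv', add_zero]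
    | smul c v _ hv => rw [dotProduct_smul, hv, smul_zero]
  · funext k
    have hk : w k ∈ V := hw ▸ Submodule.subset_span ⟨k, rfl⟩
    have := hk _ h
    rw [smul_dotProduct, smul_eq_mul] at this
    exact (mul_eq_zero.1 this).resolve_left hd

end Torsion

/-! ### Behaviors and images -/

variable {p q : ℕ}

theorem sum_smul_matrixOp (L : Matrix (Fin q) (Fin p) (DiffRing n)) (r : Fin q → DiffRing n)
    (g : Fin p → signalSpace n) :
    ∑ j, r j • matrixOp L g j = ∑ k, Matrix.vecMul r L k • g k := by
  simp only [matrixOp, LinearMap.coe_mk, AddHom.coe_mk, Finset.smul_sum, Matrix.vecMul, dotProduct,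
    Finset.sum_smul, mul_smul]
  exact Finset.sum_comm

/-- The signal space is a faithful module, since divided monomials read off every coefficient. -/
theorem eq_zero_of_smul_signalSpace_eq_zero {r : DiffRing n}
    (h : ∀ f : signalSpace n, r • f = 0) : r = 0 := by
  ext α
  have := congrArg (fun f : signalSpace n => evalZero n f)
    (h ⟨dividedMonomial α, dividedMonomial_mem α⟩)
  rw [coeff_zero, ← evalZero_smul_dividedMonomial r α]
  exact this

theorem vecMul_eq_zero_of_sum_smul_matrixOp (L : Matrix (Fin q) (Fin p) (DiffRing n))
    (r : Fin q → DiffRing n) (h : ∀ g, ∑ j, r j • matrixOp L g j = 0) :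
    Matrix.vecMul r L = 0 := by
  classical
  funext k
  refine eq_zero_of_smul_signalSpace_eq_zero fun f => ?_
  have := h (Pi.single k f)
  rw [sum_smul_matrixOp, Finset.sum_eq_single k] at this
  · rwa [Pi.single_eq_same] at this
  · intro l _ hl
    rw [Pi.single_eq_of_ne hl, smul_zero]
  · exact fun hk => absurd (Finset.mem_univ k) hk

theorem not_hasRationalPoint_of_behavior_eq_range
    (M : Submodule (DiffRing n) (Fin q → DiffRing n)) (L : Matrix (Fin q) (Fin p) (DiffRing n))
    (hL : behavior M = LinearMap.range (matrixOp L)) (P : Ideal (DiffRing n))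
    (hP : P ∈ associatedPrimes (DiffRing n) ((Fin q → DiffRing n) ⧸ M)) (h0 : P ≠ ⊥) :
    ¬ HasRationalPoint P := by
  rintro ⟨a, ha⟩
  obtain ⟨-, x, hx⟩ := isAssociatedPrime_iff.1 hP
  have hPx : ∀ r, r ∈ P ↔ r • x = 0 := fun r => by
    rw [hx, Submodule.mem_colon_singleton, Submodule.mem_bot]
  obtain ⟨r₀, rfl⟩ := Submodule.mkQ_surjective M x
  have hker : P = LinearMap.ker (LinearMap.toSpanSingleton (DiffRing n) _ (M.mkQ r₀)) := by
    ext r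
    rw [hPx, LinearMap.mem_ker, LinearMap.toSpanSingleton_apply]
  let ea : signalSpace n := ⟨expSignal a, expSignal_mem a⟩
  have hPe : P ≤ LinearMap.ker (LinearMap.toSpanSingleton (DiffRing n) _ ea) := fun r hr => by
    rw [LinearMap.mem_ker, LinearMap.toSpanSingleton_apply]
    refine Subtype.ext ?_
    change r • expSignal a = 0
    rw [smul_expSignal, show evalAt a r = 0 from ha r hr, zero_smul]
  -- As `P` is the annihilator of the class of `r₀`, `𝒟 / P` embeds in `𝒟^q / M`. The map `1 ↦ e_a`
  -- on `𝒟 / P`, well defined because `P` vanishes at `a`, extends along this embedding.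
  obtain ⟨h, hh⟩ := signalSpace_injective.out
    (P.liftQ (LinearMap.toSpanSingleton (DiffRing n) _ (M.mkQ r₀)) hker.le)
    (LinearMap.ker_eq_bot.1 (Submodule.ker_liftQ_eq_bot _ _ _ hker.ge))
    (P.liftQ (LinearMap.toSpanSingleton (DiffRing n) _ ea) hPe)
  have hr₀ : h (M.mkQ r₀) = ea := by
    have := hh (Submodule.Quotient.mk 1)
    rwa [Submodule.liftQ_apply, Submodule.liftQ_apply, LinearMap.toSpanSingleton_apply,
      LinearMap.toSpanSingleton_apply, one_smul, one_smul] at this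
  set f : Fin q → signalSpace n := fun j => h (M.mkQ fun k => if j = k then 1 else 0)
  have hsum : ∀ r : Fin q → DiffRing n, ∑ j, r j • f j = h (M.mkQ r) := fun r =>
    (LinearMap.pi_apply_eq_sum_univ (h.comp M.mkQ) r).symm
  have hfM : f ∈ behavior M := fun r hr => by
    rw [hsum, Submodule.mkQ_apply, (Submodule.Quotient.mk_eq_zero M).2 hr, map_zero]
  rw [hL] at hfM
  obtain ⟨g, hg⟩ := hfM
  obtain ⟨d, hd, hd0⟩ := Submodule.exists_mem_ne_zero_of_ne_bot h0
  have hdM : d • r₀ ∈ M := by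
    rw [← Submodule.Quotient.mk_eq_zero, Submodule.Quotient.mk_smul]
    exact (hPx d).1 hd
  have hdL : Matrix.vecMul (d • r₀) L = 0 :=
    vecMul_eq_zero_of_sum_smul_matrixOp L _ fun g' => by
      have : matrixOp L g' ∈ behavior M := hL ▸ ⟨g', rfl⟩
      exact this _ hdM
  -- Torsion-freeness of `𝒟^p` turns `d r₀ L = 0` into `r₀ L = 0`, so `r₀` annihilates the whole
  -- image of `L(D)`, including `f`.
  rw [Matrix.smul_vecMul, smul_eq_zero, or_iff_right hd0] at hdL
  have hzero : ea = 0 := by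
    rw [← hr₀, ← hsum, ← hg, sum_smul_matrixOp, hdL]
    simp
  have := congrArg (fun f : signalSpace n => evalZero n f) hzero
  exact one_ne_zero ((evalZero_expSignal a).symm.trans this)

/-! ### Torsion elements and the construction of the image representation -/

theorem exists_associatedPrime_le {R N : Type*} [CommRing R] [IsNoetherianRing R]
    [AddCommGroup N] [Module R N] (x : N) (Q : Ideal R) [Q.IsPrime]
    (hQ : ∀ r : R, r • x = 0 → r ∈ Q) :
    ∃ P ∈ associatedPrimes R N, P ≤ Q ∧ ∀ r : R, r • x = 0 → r ∈ P := by
  have hann : ∀ r : R, r ∈ Module.annihilator R (Submodule.span R {x}) ↔ r • x = 0 := fun r =>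
    Submodule.mem_annihilator_span_singleton x r
  -- A prime minimal over the annihilator of `x` is associated to the cyclic module `R x`, hence to
  -- `N`.
  obtain ⟨P, hP, hPQ⟩ := Ideal.exists_minimalPrimes_le (J := Q)
    (I := Module.annihilator R (Submodule.span R {x})) fun r hr => hQ r ((hann r).1 hr)
  exact ⟨P, IsAssociatedPrime.map_of_injective (f := (Submodule.span R {x}).subtype)
      (Module.associatedPrimes.minimalPrimes_annihilator_subset_associatedPrimes R _ hP)
      (Submodule.injective_subtype _),
    hPQ, fun r hr => hP.1.2 ((hann r).2 hr)⟩

instance (a : Fin n → ℚ) : (pointIdeal a).IsPrime := RingHom.ker_isPrime (evalAt a)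

theorem sum_smul_eq_zero_of_smul_mem (M : Submodule (DiffRing n) (Fin q → DiffRing n))
    (hM : ∀ P ∈ associatedPrimes (DiffRing n) ((Fin q → DiffRing n) ⧸ M),
      P ≠ ⊥ → ¬ HasRationalPoint P)
    {f : Fin q → signalSpace n} (hf : f ∈ behavior M) {d : DiffRing n} (hd : d ≠ 0)
    {r : Fin q → DiffRing n} (hr : d • r ∈ M) : ∑ j, r j • f j = 0 := by
  by_contra h0
  obtain ⟨s, a, hs⟩ := exists_smul_eq_expSignal (∑ j, r j • f j : signalSpace n).2
    fun h => h0 (Subtype.ext h)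
  have hmem : ∀ t : DiffRing n, t • M.mkQ r = 0 ↔ t • r ∈ M := fun t => by
    rw [← map_smul, Submodule.mkQ_apply, Submodule.Quotient.mk_eq_zero]
  obtain ⟨P, hP, hPa, hxP⟩ := exists_associatedPrime_le (M.mkQ r) (pointIdeal a) fun t ht => by
    have h1 : t • ∑ j, r j • f j = 0 := by
      have := hf _ ((hmem t).1 ht)
      simpa only [Pi.smul_apply, smul_eq_mul, mul_smul, ← Finset.smul_sum] using this
    have h2 : t • expSignal a = 0 := by
      rw [← hs, smul_comm, ← Submodule.coe_smul, h1]
      exact smul_zero s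
    rw [smul_expSignal] at h2
    have := congrArg (evalZero n) h2
    rwa [map_smul, evalZero_expSignal, smul_eq_mul, mul_one, map_zero] at this
  refine hM P hP ?_ ⟨a, fun t ht => hPa ht⟩
  -- The prime contains the annihilator of the class of `r`, in particular `d ≠ 0`.
  rintro rfl
  exact hd (hxP d ((hmem d).2 hr))

theorem exists_behavior_eq_range (M : Submodule (DiffRing n) (Fin q → DiffRing n))
    (hM : ∀ P ∈ associatedPrimes (DiffRing n) ((Fin q → DiffRing n) ⧸ M),
      P ≠ ⊥ → ¬ HasRationalPoint P) :
    ∃ (p : ℕ) (L : Matrix (Fin q) (Fin p) (DiffRing n)),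
      behavior M = LinearMap.range (matrixOp L) := by
  classical
  obtain ⟨p, L, hL⟩ := exists_matrix_vecMul_eq_zero_iff M
  refine ⟨p, L, le_antisymm (fun f hf => ?_) ?_⟩
  · let ρ : (Fin q → DiffRing n) →ₗ[DiffRing n] (Fin p → DiffRing n) := Matrix.vecMulLinear L
    let φ : (Fin q → DiffRing n) →ₗ[DiffRing n] signalSpace n :=
      ∑ j, (LinearMap.proj j).smulRight (f j)
    have hφ : ∀ r, φ r = ∑ j, r j • f j := fun r => by simp [φ]
    have hker : LinearMap.ker ρ ≤ LinearMap.ker φ := fun r hr => by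
      obtain ⟨d, hd, hdr⟩ := (hL r).1 hr
      rw [LinearMap.mem_ker, hφ]
      exact sum_smul_eq_zero_of_smul_mem M hM hf hd hdr
    -- Since `r ↦ r · f` vanishes on the left kernel of `L`, it factors through the image of `ρ` in
    -- `𝒟^p` and extends to `h` on `𝒟^p`. The values of `h` on the standard basis form the preimage
    -- of `f`.
    obtain ⟨h, hh⟩ := signalSpace_injective.out ((LinearMap.ker ρ).liftQ ρ le_rfl)
      (LinearMap.ker_eq_bot.1 (Submodule.ker_liftQ_eq_bot _ _ _ le_rfl))
      ((LinearMap.ker ρ).liftQ φ hker)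
    have hρ : ∀ r, h (ρ r) = φ r := fun r => hh (Submodule.Quotient.mk r)
    refine ⟨fun k => h fun l => if k = l then 1 else 0, ?_⟩
    funext j
    have hj := hρ (Pi.single j 1)
    rw [hφ, Finset.sum_eq_single j (fun l _ hl => by rw [Pi.single_eq_of_ne hl, zero_smul])
      (by simp), Pi.single_eq_same, one_smul] at hj
    have hρj : ρ (Pi.single j 1) = L j := Matrix.single_one_vecMul j L
    rw [← hj, hρj, LinearMap.pi_apply_eq_sum_univ h]
    rfl
  · rintro _ ⟨g, rfl⟩ r hr
    rw [sum_smul_matrixOp, (hL r).2 ⟨1, one_ne_zero, by rwa [one_smul]⟩]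
    simp

end PeriodicBehavior
end

theorem theorem4p2 (n q : ℕ)
    (M : Submodule (PeriodicBehavior.DiffRing n) (Fin q → PeriodicBehavior.DiffRing n)) :
    (∃ (p : ℕ) (L : Matrix (Fin q) (Fin p) (PeriodicBehavior.DiffRing n)),
        PeriodicBehavior.behavior M = LinearMap.range (PeriodicBehavior.matrixOp L)) ↔
      ∀ P ∈ associatedPrimes (PeriodicBehavior.DiffRing n)
          ((Fin q → PeriodicBehavior.DiffRing n) ⧸ M),
        P ≠ ⊥ → ¬ PeriodicBehavior.HasRationalPoint P :=
  ⟨fun ⟨_, L, hL⟩ P hP h0 =>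
      PeriodicBehavior.not_hasRationalPoint_of_behavior_eq_range M L hL P hP h0,
    PeriodicBehavior.exists_behavior_eq_range M⟩
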